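/- A planar body is a compact convex set $K\subset\mathbb R^2$ with non-empty interior. Its Minkowski asymmetry is $s(K)=\inf\{\rho>0: K-c\subset\rho(c-K)\text{ for some }c\in\mathbb R^2\}$, and $K$ is Minkowski centered if $K\subset -s(K)K$. For sets $A,C\subset\mathbb R^2$ write $A\subset^{opt}C$ if $A\subset C$ and, for every $\rho\in[0,1)$, no translate of $\rho C$ contains $A$; $\alpha(K)$ denotes the number $\alpha>0$ with $K\cap(-K)\subset^{opt}\alpha\,\mathrm{conv}(K\cup(-K))$. Let $\varphi=\frac{1+\sqrt5}{2}$, and for $s\in(\varphi,2]$ put \[ K_{min,s}=\mathrm{conv}\left\{\begin{pmatrix}\pm\frac{s}{s^2-1}\\0\end{pmatrix},\begin{pmatrix}0\\-s^2\end{pmatrix},\begin{pmatrix}\pm1\\s\end{pmatrix}\right\},\qquad K_{max,s}=\mathrm{conv}\left\{\begin{pmatrix}\pm1\\s(s^2-s-1)\end{pmatrix},\begin{pmatrix}0\\-s^2\end{pmatrix},\begin{pmatrix}\pm1\\s\end{pmatrix}\right\}. \] (a) Let $K$ be a Minkowski centered planar body with $s(K)>\varphi$ and $\alpha(K)=\frac{s(K)}{s(K)^2-1}$.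 Then there exists a non-singular linear transformation $L$ of $\mathbb R^2$ such that $K_{min,s(K)}\subset L(K)\subset K_{max,s(K)}$. (Here $s(K)\le 2$ holds for every planar body.) (b) Conversely, for every $s\in(\varphi,2]$, every planar body $K$ with $K_{min,s}\subset K\subset K_{max,s}$ satisfies $\alpha(K)=\frac{s}{s^2-1}$. -/

import Mathlib

open scoped Pointwise

namespace ConvexAsym

section General

variable {E : Type*} [AddCommGroup E] [Module ℝ E]

/-- `A ⊂_t C`: the set `A` is contained in some translate of `C`. -/
def SubsetTranslate (A C : Set E) : Prop :=
  ∃ t : E, A ⊆ C + {t}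

/-- `A ⊂^opt C`: `A` is contained in `C`, but no translate of a smaller dilate
`ρ C`, `0 ≤ ρ < 1`, contains `A`. -/
def OptContained (A C : Set E) : Prop :=
  A ⊆ C ∧ ∀ ρ : ℝ, 0 ≤ ρ → ρ < 1 → ¬ SubsetTranslate A (ρ • C)

/-- The Minkowski asymmetry
`s(K) = inf {ρ > 0 : K - c ⊆ ρ (c - K) for some c}`. -/
noncomputable def asymmetry (K : Set E) : ℝ :=
  sInf {ρ : ℝ | 0 < ρ ∧ ∃ c : E, K - {c} ⊆ ρ • ({c} - K)}

/-- `c` is a Minkowski center of `K`. -/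
def IsMinkowskiCenter (K : Set E) (c : E) : Prop :=
  K - {c} ⊆ asymmetry K • ({c} - K)

/-- `K` is Minkowski centered: the origin is a Minkowski center of `K`. -/
def IsMinkowskiCentered (K : Set E) : Prop :=
  IsMinkowskiCenter K 0

/-- `α(K)`: the positive number `a` with `K ∩ (-K) ⊂^opt a conv(K ∪ (-K))`. There is at most
one such number, see `alpha_eq_iff`; the infimum only serves to pick it (and gives the value
`0` when there is none). -/
noncomputable def alpha (K : Set E) : ℝ :=
  sInf {a : ℝ | 0 < a ∧ OptContained (K ∩ -K) (a • convexHull ℝ (K ∪ -K))}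

theorem not_lt_of_optContained {A C : Set E} {a b : ℝ} (ha : 0 < a)
    (hA : OptContained A (a • C)) (hB : OptContained A (b • C)) : ¬ a < b := by
  intro hab
  have hb : 0 < b := ha.trans hab
  refine hB.2 (a / b) (by positivity) ((div_lt_one hb).2 hab) ⟨0, ?_⟩
  have h : (a / b) • b • C = a • C := by
    rw [smul_smul, div_mul_cancel₀ a hb.ne']
  rw [h]
  simpa using hA.1

/-- For positive `a`, the equation `α(K) = a` means exactly that `K ∩ (-K)` is optimally
contained in `a conv(K ∪ (-K))`. -/
theorem alpha_eq_iff {K : Set E} {a : ℝ} (ha : 0 < a) :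
    alpha K = a ↔ OptContained (K ∩ -K) (a • convexHull ℝ (K ∪ -K)) := by
  have key : ∀ b : ℝ, 0 < b → OptContained (K ∩ -K) (b • convexHull ℝ (K ∪ -K)) →
      alpha K = b := by
    intro b hb h
    have hset : {a : ℝ | 0 < a ∧ OptContained (K ∩ -K) (a • convexHull ℝ (K ∪ -K))} = {b} := by
      ext c
      constructor
      · rintro ⟨hc, h'⟩
        exact le_antisymm (not_lt.1 (not_lt_of_optContained hb h h'))
          (not_lt.1 (not_lt_of_optContained hc h' h))
      · rintro rfl
        exact ⟨hb, h⟩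
    rw [alpha, hset, csInf_singleton]
  refine ⟨fun h => ?_, key a ha⟩
  by_cases hne : {a : ℝ | 0 < a ∧ OptContained (K ∩ -K) (a • convexHull ℝ (K ∪ -K))}.Nonempty
  · obtain ⟨b, hb, hb'⟩ := hne
    have hba := key b hb hb'
    rw [h] at hba
    rwa [hba]
  · rw [alpha, Set.not_nonempty_iff_eq_empty.1 hne, Real.sInf_empty] at h
    exact absurd h ha.ne

end General

/-- The Euclidean plane. -/
abbrev Plane : Type := EuclideanSpace ℝ (Fin 2)

/-- A planar (convex) body: a compact convex set with non-empty interior. -/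
structure IsBody (K : Set Plane) : Prop where
  isCompact : IsCompact K
  convex : Convex ℝ K
  nonempty_interior : (interior K).Nonempty

/-- `K_{min,s}`. -/
noncomputable def Kmin (s : ℝ) : Set Plane :=
  convexHull ℝ {!₂[s / (s ^ 2 - 1), 0], !₂[-(s / (s ^ 2 - 1)), 0], !₂[0, -s ^ 2],
    !₂[1, s], !₂[-1, s]}

/-- `K_{max,s}`. -/
noncomputable def Kmax (s : ℝ) : Set Plane :=
  convexHull ℝ {!₂[1, s * (s ^ 2 - s - 1)], !₂[-1, s * (s ^ 2 - s - 1)], !₂[0, -s ^ 2],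
    !₂[1, s], !₂[-1, s]}

end ConvexAsym

/-! Write `s` for the asymmetry and `α = s / (s ^ 2 - 1)`.

For (a), optimality of `K ⊆ -s K` puts `0` in the convex hull of the contact normals, and `s > 1`
rules out two opposite ones. After scaling there are three normals `a i` with sum zero, a triangle
`⟪a i, x⟫ ≥ -H i` containing `K`, and points `q i ∈ K` with `⟪a i, q i⟫ = s * H i`
(`exists_isContactTriple`). Optimality for `α` gives `±p ∈ K` and a normal `v` with `α * |⟪v, x⟫| ≤
⟪v, p⟫` on `K` (`exists_touching_of_optContained`). With `v = μ a 1 - ν a 2`, `μ, ν ≥ 0`, the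
triangle bounds `⟪v, p⟫` above, while `q 1` and `q 2` bound it below. For this `α` every inequality
is tight (`extremal_coefficients`). In the coordinates `a 1 - a 2` and `-a 0`, suitably scaled, `±p`
and the `q i` are the vertices of `Kmin`, and the triangle cut by the strip of `v` is `Kmax`.

For (b), `Kmax` bounds `K ∩ -K` from above and the vertices of `Kmin` bound `conv (K ∪ -K)` from
below. The points `(±α, 0)` and the strip `|x 0| ≤ 1` give optimality. -/

namespace ConvexAsym

open Filter Topology
open scoped RealInnerProductSpace

/-! ### Compactness, separation and first-order conditions for optimal containment -/

/-- In finite dimension the convex hull of a compact set is compact. -/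
theorem isCompact_convexHull_of_isCompact {E : Type*} [NormedAddCommGroup E] [NormedSpace ℝ E]
    [FiniteDimensional ℝ E] {S : Set E} (hS : IsCompact S) : IsCompact (convexHull ℝ S) := by
  rcases S.eq_empty_or_nonempty with rfl | ⟨x₀, hx₀⟩
  · simp
  let d := Module.finrank ℝ E + 1
  have hc : IsCompact ((stdSimplex ℝ (Fin d)) ×ˢ (Set.univ.pi fun _ : Fin d => S)) :=
    (isCompact_stdSimplex ℝ (Fin d)).prod (isCompact_univ_pi fun _ => hS)
  have hf : Continuous fun q : (Fin d → ℝ) × (Fin d → E) => ∑ i, q.1 i • q.2 i := by fun_prop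
  convert hc.image hf using 1
  ext x
  constructor
  · intro hx
    obtain ⟨ι, _, z, w, hz, hind, hw, hw1, hx⟩ := eq_pos_convex_span_of_mem_convexHull hx
    have hcard : Fintype.card ι ≤ Fintype.card (Fin d) := by
      rw [Fintype.card_fin]
      exact hind.card_le_finrank_succ.trans (Nat.succ_le_succ (Submodule.finrank_le _))
    obtain ⟨e⟩ := Function.Embedding.nonempty_of_card_le hcard
    -- Carathéodory may use fewer than `d` points; the remaining slots get weight `0` and the dummy
    -- point `x₀`.
    have hW : ∀ i, Function.extend e w 0 (e i) = w i := fun i => e.injective.extend_apply _ _ _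
    have hZ : ∀ i, Function.extend e z (fun _ => x₀) (e i) = z i :=
      fun i => e.injective.extend_apply _ _ _
    have hW0 : ∀ i, i ∉ Set.range e → Function.extend e w 0 i = 0 := fun i hi => by
      rw [Function.extend_apply' _ _ _ (by simpa using hi)]; rfl
    refine ⟨(Function.extend e w 0, Function.extend e z fun _ => x₀), ⟨⟨?_, ?_⟩, ?_⟩, ?_⟩
    · intro i
      by_cases hi : i ∈ Set.range e
      · obtain ⟨j, rfl⟩ := hi
        exact (hw j).le.trans_eq (hW j).symm
      · exact (hW0 i hi).ge
    · rw [← hw1]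
      exact (Fintype.sum_of_injective e e.injective _ _ hW0 fun i => (hW i).symm).symm
    · intro i _
      by_cases hi : i ∈ Set.range e
      · obtain ⟨j, rfl⟩ := hi
        change Function.extend e z (fun _ => x₀) (e j) ∈ S
        rw [hZ]
        exact hz ⟨j, rfl⟩
      · change Function.extend e z (fun _ => x₀) i ∈ S
        rwa [Function.extend_apply' _ _ _ (by simpa using hi)]
    · rw [← hx]
      refine (Fintype.sum_of_injective e e.injective _ _ (fun i hi => ?_) fun i => ?_).symm
      · simp only [hW0 i hi, zero_smul]
      · simp only [hW, hZ]
  · rintro ⟨⟨w, z⟩, ⟨⟨hw, hw1⟩, hz⟩, rfl⟩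
    exact (convex_convexHull ℝ S).sum_mem (fun i _ => hw i) hw1
      fun i _ => subset_convexHull ℝ S (hz i trivial)

/-- A point outside a closed convex set is strictly separated from it by a unit normal. -/
theorem exists_unit_inner_lt {E : Type*} [NormedAddCommGroup E] [InnerProductSpace ℝ E]
    [CompleteSpace E] {D : Set E} (hD : Convex ℝ D) (hc : IsClosed D) (hne : D.Nonempty) {x : E}
    (hx : x ∉ D) : ∃ a : E, ‖a‖ = 1 ∧ ∀ y ∈ D, ⟪a, y⟫ < ⟪a, x⟫ := by
  obtain ⟨f, u, hf, hu⟩ := geometric_hahn_banach_closed_point hD hc hx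
  set b := (InnerProductSpace.toDual ℝ E).symm f with hb
  have hbf : ∀ y, ⟪b, y⟫ = f y := fun y => InnerProductSpace.toDual_symm_apply
  have hb0 : b ≠ 0 := by
    intro h0
    obtain ⟨y, hy⟩ := hne
    have h1 := (hf y hy).trans hu
    rw [← hbf, ← hbf, h0, inner_zero_left, inner_zero_left] at h1
    exact lt_irrefl _ h1
  refine ⟨‖b‖⁻¹ • b, norm_smul_inv_norm hb0, fun y hy => ?_⟩
  rw [real_inner_smul_left, real_inner_smul_left, hbf, hbf]
  exact mul_lt_mul_of_pos_left ((hf y hy).trans hu) (by positivity)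

theorem IsMinkowskiCentered.exists_eq_neg_smul {E : Type*} [AddCommGroup E] [Module ℝ E]
    {K : Set E} (h : IsMinkowskiCentered K) {x : E} (hx : x ∈ K) :
    ∃ y ∈ K, x = -(asymmetry K • y) := by
  have h1 : x ∈ asymmetry K • ({0} - K) := h (by simpa using hx)
  obtain ⟨z, hz, rfl⟩ := h1
  refine ⟨-z, by simpa using hz, by simp⟩

/-- If `K ⊆ v - ρ K`, then the fixed point `v / (1 + ρ)` of `x ↦ v - ρ x` serves as a center, so `ρ`
is admissible in the infimum. -/
theorem not_subset_of_lt_asymmetry {E : Type*} [AddCommGroup E] [Module ℝ E] {K : Set E} {ρ : ℝ}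
    (hρ : 0 < ρ) (hlt : ρ < asymmetry K) (v : E) : ∃ x ∈ K, ∀ y ∈ K, x ≠ v - ρ • y := by
  by_contra! hcon
  refine absurd (csInf_le ⟨0, fun r hr => hr.1.le⟩ ?_) (not_le.2 hlt)
  refine ⟨hρ, (1 + ρ)⁻¹ • v, ?_⟩
  rintro _ ⟨x, hx, _, rfl, rfl⟩
  obtain ⟨y, hy, rfl⟩ := hcon x hx
  refine ⟨(1 + ρ)⁻¹ • v - y, ⟨_, rfl, y, hy, rfl⟩, ?_⟩
  have h1 : v = (1 + ρ) • (1 + ρ)⁻¹ • v := by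
    rw [smul_smul, mul_inv_cancel₀ (by positivity), one_smul]
  have h2 : ∀ c : E, ρ • (c - y) = (1 + ρ) • c - ρ • y - c := fun c => by module
  simp only [h2, ← h1]

/-- A Minkowski centered body has the origin in its interior, in the form that no linear
functional is non-negative on it. -/
theorem IsMinkowskiCentered.exists_inner_neg {K : Set Plane} (hK : IsBody K)
    (hc : IsMinkowskiCentered K) (hs : 0 < asymmetry K) {a : Plane} (ha : a ≠ 0) :
    ∃ x ∈ K, ⟪a, x⟫ < 0 := by
  by_contra! hcon
  -- Writing `x = -s y` with `y ∈ K` gives the functional both signs, so it vanishes on `K`, against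
  -- the non-empty interior.
  have h0 : ∀ x ∈ K, ⟪a, x⟫ = 0 := by
    intro x hx
    obtain ⟨y, hy, rfl⟩ := hc.exists_eq_neg_smul hx
    have h1 := hcon _ hx
    have h2 := hcon _ hy
    rw [inner_neg_right, real_inner_smul_right] at h1 ⊢
    nlinarith
  obtain ⟨x, hx⟩ := hK.nonempty_interior
  have hcont : Continuous fun r : ℝ => x + r • a := by fun_prop
  have hev : ∀ᶠ r : ℝ in 𝓝 0, x + r • a ∈ interior K :=
    hcont.continuousAt.eventually_mem (by simpa using isOpen_interior.mem_nhds hx)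
  obtain ⟨ε, hε, hball⟩ := Metric.eventually_nhds_iff.1 hev
  have h1 := h0 _ (interior_subset (@hball (ε / 2)
    (by rw [Real.dist_eq, sub_zero, abs_of_pos (by positivity)]; linarith)))
  rw [inner_add_right, h0 _ (interior_subset hx), real_inner_smul_right, zero_add] at h1
  have h2 : 0 < ⟪a, a⟫ := real_inner_self_pos.2 ha
  have : 0 < ε / 2 * ⟪a, a⟫ := by positivity
  linarith

/-- The unit outer normals `a` at common boundary points of `K` and `-s K`. -/
def contactNormals (K : Set Plane) (s : ℝ) : Set Plane :=
  {a | ‖a‖ = 1 ∧ ∃ p ∈ K, ∀ x ∈ K, 0 ≤ s * ⟪a, x⟫ + ⟪a, p⟫}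

/-- The set is the projection of a closed subset of the compact product of the unit sphere and `K`.
-/
theorem isCompact_contactNormals {K : Set Plane} (hK : IsCompact K) (s : ℝ) :
    IsCompact (contactNormals K s) := by
  have h1 : IsClosed {q : Plane × Plane | ∀ x ∈ K, 0 ≤ s * ⟪q.1, x⟫ + ⟪q.1, q.2⟫} := by
    simp only [Set.ofPred_forall]
    exact isClosed_biInter fun x _ => isClosed_le (by fun_prop) (by fun_prop)
  have h2 := (((isCompact_sphere (0 : Plane) 1).prod hK).inter_right h1).image continuous_fst
  refine (congrArg IsCompact (Set.ext fun a => ?_)).mpr h2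
  constructor
  · rintro ⟨ha, p, hp, h⟩
    exact ⟨(a, p), ⟨⟨by simpa using ha, hp⟩, h⟩, rfl⟩
  · rintro ⟨⟨a, p⟩, ⟨⟨ha, hp⟩, h⟩, rfl⟩
    exact ⟨by simpa using ha, p, hp, h⟩

theorem tendsto_inner_of_prod {ι : Type*} {l : Filter ι} {u : ι → Plane × Plane} {a p : Plane}
    (h : Tendsto u l (𝓝 (a, p))) :
    Tendsto (fun i => ⟪(u i).1, (u i).2⟫) l (𝓝 ⟪a, p⟫) :=
  ((continuous_fst.tendsto _).comp h).inner ((continuous_snd.tendsto _).comp h)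

/-- Optimality of the containment `K ⊆ -s(K) K`: the origin is a convex combination of contact
normals. -/
theorem zero_mem_convexHull_contactNormals {K : Set Plane} (hK : IsBody K)
    (hc : IsMinkowskiCentered K) (hs : 1 < asymmetry K) :
    (0 : Plane) ∈ convexHull ℝ (contactNormals K (asymmetry K)) := by
  set s := asymmetry K with hsdef
  by_contra h0
  obtain ⟨t, ht⟩ : ∃ t : Plane, ∀ a ∈ contactNormals K s, 0 < ⟪a, t⟫ := by
    rcases (contactNormals K s).eq_empty_or_nonempty with he | hne
    · exact ⟨0, by simp [he]⟩
    obtain ⟨b, -, hb⟩ := exists_unit_inner_lt (convex_convexHull ℝ _)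
      (isCompact_convexHull_of_isCompact (isCompact_contactNormals hK.isCompact s)).isClosed
      (hne.convexHull) h0
    refine ⟨-b, fun a ha => ?_⟩
    have := hb a (subset_convexHull ℝ _ ha)
    rw [inner_zero_right, real_inner_comm] at this
    rw [inner_neg_right]
    linarith
  -- Translate by `ε t` but shrink the factor only by `ε ^ 2`: the first-order gain from `t` must
  -- dominate, yet containment still fails by definition of `s`.
  let ε : ℕ → ℝ := fun n => 1 / ((n : ℝ) + 1)
  have hε0 : ∀ n, 0 < ε n := fun n => Nat.one_div_pos_of_nat
  have hε1 : ∀ n, ε n ≤ 1 := fun n => by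
    have : (0 : ℝ) ≤ n := n.cast_nonneg
    exact (div_le_one (by linarith)).2 (by linarith)
  have hεlim : Tendsto ε atTop (𝓝 0) := tendsto_one_div_add_atTop_nhds_zero_nat
  have hsq : ∀ n, 0 < s - ε n ^ 2 := fun n => by nlinarith [hε0 n, hε1 n]
  have key : ∀ n, ∃ q : Plane × Plane, q ∈ Metric.sphere (0 : Plane) 1 ×ˢ K ∧
      ∀ y ∈ K, ε n * ⟪q.1, t⟫ - (s - ε n ^ 2) * ⟪q.1, y⟫ < ⟪q.1, q.2⟫ := by
    intro n
    obtain ⟨x, hx, hxy⟩ := not_subset_of_lt_asymmetry (hsq n)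
      (by have := hε0 n; nlinarith : s - ε n ^ 2 < asymmetry K) (ε n • t)
    have himg : (fun y => ε n • t - (s - ε n ^ 2) • y) '' K
        = (ε n • t) +ᵥ (-(s - ε n ^ 2)) • K := by
      ext z
      simp only [Set.mem_vadd_set, Set.mem_smul_set, Set.mem_image, exists_exists_and_eq_and,
        vadd_eq_add, neg_smul, sub_eq_add_neg]
    have hcl : IsClosed ((fun y => ε n • t - (s - ε n ^ 2) • y) '' K) :=
      (hK.isCompact.image (by fun_prop)).isClosed
    have hcv : Convex ℝ ((fun y => ε n • t - (s - ε n ^ 2) • y) '' K) := by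
      rw [himg]
      exact (hK.convex.smul _).vadd _
    obtain ⟨a, ha, hay⟩ := exists_unit_inner_lt hcv hcl (Set.Nonempty.image _ ⟨x, hx⟩) (x := x) (by
      rintro ⟨y, hy, h⟩
      exact hxy y hy h.symm)
    refine ⟨(a, x), ⟨by simpa using ha, hx⟩, fun y hy => ?_⟩
    have := hay _ ⟨y, hy, rfl⟩
    simpa only [inner_sub_right, real_inner_smul_right] using this
  choose q hq hqy using key
  obtain ⟨⟨a, p⟩, ⟨ha, hp⟩, φ, hφ, hlim⟩ :=
    ((isCompact_sphere (0 : Plane) 1).prod hK.isCompact).tendsto_subseq hq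
  have hlim1 : Tendsto (fun i => (q (φ i)).1) atTop (𝓝 a) := (continuous_fst.tendsto _).comp hlim
  have hin : Tendsto (fun i => ⟪(q (φ i)).1, (q (φ i)).2⟫) atTop (𝓝 ⟪a, p⟫) :=
    tendsto_inner_of_prod hlim
  have hint : Tendsto (fun i => ⟪(q (φ i)).1, t⟫) atTop (𝓝 ⟪a, t⟫) :=
    hlim1.inner tendsto_const_nhds
  have hε : Tendsto (fun i => ε (φ i)) atTop (𝓝 0) := hεlim.comp hφ.tendsto_atTop
  have haN : a ∈ contactNormals K s := by
    refine ⟨by simpa using ha, p, hp, fun y hy => ?_⟩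
    have h1 : Tendsto (fun i => ε (φ i) * ⟪(q (φ i)).1, t⟫
        - (s - ε (φ i) ^ 2) * ⟪(q (φ i)).1, y⟫) atTop (𝓝 (0 * ⟪a, t⟫ - (s - 0 ^ 2) * ⟪a, y⟫)) :=
      (hε.mul hint).sub ((tendsto_const_nhds.sub (hε.pow 2)).mul (hlim1.inner tendsto_const_nhds))
    have := le_of_tendsto_of_tendsto' h1 hin fun i => (hqy (φ i) y hy).le
    linarith
  -- Inserting `x = -s y` into the separation inequality cancels the terms of order zero. Dividing
  -- by `ε` leaves `⟪a, t⟫` below a term of order `ε`.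
  have hle : ⟪a, t⟫ ≤ 0 * s⁻¹ * ⟪a, p⟫ := by
    refine le_of_tendsto_of_tendsto' hint ((hε.mul tendsto_const_nhds).mul hin) fun i => ?_
    obtain ⟨y, hy, hxy⟩ := hc.exists_eq_neg_smul (hq (φ i)).2
    have h1 := hqy (φ i) y hy
    have h2 : ⟪(q (φ i)).1, (q (φ i)).2⟫ = -(s * ⟪(q (φ i)).1, y⟫) := by
      conv_lhs => rw [hxy]
      rw [inner_neg_right, real_inner_smul_right]
    have h3 : ⟪(q (φ i)).1, y⟫ = -(s⁻¹ * ⟪(q (φ i)).1, (q (φ i)).2⟫) := by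
      rw [h2]; field_simp
    have hss : s * s⁻¹ = 1 := mul_inv_cancel₀ (by positivity)
    set w := ⟪(q (φ i)).1, (q (φ i)).2⟫
    have h4 : ε (φ i) * ⟪(q (φ i)).1, t⟫ < ε (φ i) * (ε (φ i) * s⁻¹ * w) := by
      rw [h3] at h1
      linear_combination h1 - w * hss
    exact (lt_of_mul_lt_mul_left h4 (hε0 _).le).le
  have := ht a haN
  linarith

/-- Optimality of `K ∩ -K ⊆ α conv (K ∪ -K)`: there is a touching point with a common normal. -/
theorem exists_touching_of_optContained {K : Set Plane} (hK : IsBody K) {α : ℝ}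
    (h : OptContained (K ∩ -K) (α • convexHull ℝ (K ∪ -K))) :
    ∃ a : Plane, ‖a‖ = 1 ∧ ∃ p ∈ K, -p ∈ K ∧ ∀ x ∈ K, α * |⟪a, x⟫| ≤ ⟪a, p⟫ := by
  let ρ : ℕ → ℝ := fun n => 1 - 1 / ((n : ℝ) + 1)
  have hρ1 : ∀ n, ρ n < 1 := fun n => by
    have : 0 < 1 / ((n : ℝ) + 1) := Nat.one_div_pos_of_nat
    simp only [ρ]; linarith
  have hρ0 : ∀ n, 0 ≤ ρ n := fun n => by
    have : (0 : ℝ) ≤ n := n.cast_nonneg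
    have : 1 / ((n : ℝ) + 1) ≤ 1 := (div_le_one (by linarith)).2 (by linarith)
    simp only [ρ]; linarith
  have hρlim : Tendsto ρ atTop (𝓝 (1 - 0)) :=
    tendsto_const_nhds.sub tendsto_one_div_add_atTop_nhds_zero_nat
  have hcomp : IsCompact (K ∩ -K) := hK.isCompact.inter hK.isCompact.neg
  have hne : (convexHull ℝ (K ∪ -K)).Nonempty := by
    obtain ⟨x, hx⟩ := hK.nonempty_interior
    exact ⟨x, subset_convexHull ℝ _ (Or.inl (interior_subset hx))⟩
  have key : ∀ n, ∃ q : Plane × Plane, q ∈ Metric.sphere (0 : Plane) 1 ×ˢ (K ∩ -K) ∧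
      ∀ y ∈ convexHull ℝ (K ∪ -K), ρ n * (α * ⟪q.1, y⟫) < ⟪q.1, q.2⟫ := by
    intro n
    -- Only the zero translation is needed.
    have h1 : ¬ K ∩ -K ⊆ ρ n • α • convexHull ℝ (K ∪ -K) := fun hsub =>
      h.2 (ρ n) (hρ0 n) (hρ1 n) ⟨0, by simpa using hsub⟩
    obtain ⟨x, hx, hxn⟩ := Set.not_subset.1 h1
    obtain ⟨a, ha, hay⟩ := exists_unit_inner_lt (((convex_convexHull ℝ _).smul _).smul _)
      (((isCompact_convexHull_of_isCompact
        (hK.isCompact.union hK.isCompact.neg)).smul _).smul _).isClosed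
      (hne.smul_set.smul_set) hxn
    refine ⟨(a, x), ⟨by simpa using ha, hx⟩, fun y hy => ?_⟩
    have := hay _ (Set.smul_mem_smul_set (Set.smul_mem_smul_set hy))
    simpa only [real_inner_smul_right] using this
  choose q hq hqy using key
  obtain ⟨⟨a, p⟩, ⟨ha, hp⟩, φ, hφ, hlim⟩ :=
    ((isCompact_sphere (0 : Plane) 1).prod hcomp).tendsto_subseq hq
  have hlim1 : Tendsto (fun i => (q (φ i)).1) atTop (𝓝 a) := (continuous_fst.tendsto _).comp hlim
  have hin : Tendsto (fun i => ⟪(q (φ i)).1, (q (φ i)).2⟫) atTop (𝓝 ⟪a, p⟫) :=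
    tendsto_inner_of_prod hlim
  have hle : ∀ y ∈ convexHull ℝ (K ∪ -K), α * ⟪a, y⟫ ≤ ⟪a, p⟫ := by
    intro y hy
    have h1 : Tendsto (fun i => ρ (φ i) * (α * ⟪(q (φ i)).1, y⟫)) atTop
        (𝓝 ((1 - 0) * (α * ⟪a, y⟫))) :=
      (hρlim.comp hφ.tendsto_atTop).mul
        (tendsto_const_nhds.mul (hlim1.inner tendsto_const_nhds))
    have := le_of_tendsto_of_tendsto' h1 hin fun i => (hqy (φ i) y hy).le
    linarith
  refine ⟨a, by simpa using ha, p, hp.1, hp.2, fun x hx => ?_⟩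
  have h1 := hle x (subset_convexHull ℝ _ (Or.inl hx))
  have h2 := hle (-x) (subset_convexHull ℝ _ (Or.inr (by simpa using hx)))
  rw [inner_neg_right] at h2
  rcases abs_cases ⟪a, x⟫ with ⟨h, -⟩ | ⟨h, -⟩ <;> rw [h] <;> linarith

end ConvexAsym

/-! ### Inequalities for `Kmax` and part (b) -/

namespace ConvexAsym

theorem plane_mk_mem_of_between {D : Set Plane} (hD : Convex ℝ D) {x y y₁ y₂ : ℝ}
    (h1 : !₂[x, y₁] ∈ D) (h2 : !₂[x, y₂] ∈ D) (hy1 : y₁ ≤ y) (hy2 : y ≤ y₂) : !₂[x, y] ∈ D := by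
  rcases (hy1.trans hy2).eq_or_lt with h | h
  · rwa [le_antisymm hy1 (h ▸ hy2)] at h1
  · have hpos : 0 < y₂ - y₁ := sub_pos.2 h
    convert hD h1 h2 (a := (y₂ - y) / (y₂ - y₁)) (b := (y - y₁) / (y₂ - y₁))
      (div_nonneg (by linarith) hpos.le) (div_nonneg (by linarith) hpos.le)
      (by field_simp; ring) using 1
    ext i
    fin_cases i <;> simp <;> field_simp <;> ring

theorem plane_mk_mem_of_abs_le {D : Set Plane} (hD : Convex ℝ D) {c d x : ℝ}
    (h0 : !₂[0, c] ∈ D) (h1 : !₂[1, d] ∈ D) (h2 : !₂[-1, d] ∈ D) (hx : |x| ≤ 1) :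
    !₂[x, c + (d - c) * |x|] ∈ D := by
  rcases abs_cases x with ⟨h, hx0⟩ | ⟨h, hx0⟩
  · rw [h] at hx ⊢
    convert hD h0 h1 (a := 1 - x) (b := x) (by linarith) hx0 (by ring) using 1
    ext i
    fin_cases i <;> simp
    ring
  · rw [h] at hx ⊢
    convert hD h0 h2 (a := 1 + x) (b := -x) (by linarith) (by linarith) (by ring) using 1
    ext i
    fin_cases i <;> simp
    ring

theorem plane_eta (x : Plane) : !₂[x 0, x 1] = x := by
  ext i
  fin_cases i <;> simp

/-- Such a point lies on a vertical segment from a lower edge, of slope `±(s ^ 3 - s)`, to the top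
edge. -/
theorem mem_Kmax_of {s : ℝ} {x : Plane} (h0 : |x 0| ≤ 1) (h1 : x 1 ≤ s)
    (h2 : -s ^ 2 + (s ^ 3 - s) * |x 0| ≤ x 1) : x ∈ Kmax s := by
  rw [← plane_eta x]
  have hD : Convex ℝ (Kmax s) := convex_convexHull ℝ _
  have a1 : !₂[0, -s ^ 2] ∈ Kmax s := subset_convexHull ℝ _ (by simp)
  have a2 : !₂[1, s * (s ^ 2 - s - 1)] ∈ Kmax s := subset_convexHull ℝ _ (by simp)
  have a3 : !₂[-1, s * (s ^ 2 - s - 1)] ∈ Kmax s := subset_convexHull ℝ _ (by simp)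
  have a4 : !₂[1, s] ∈ Kmax s := subset_convexHull ℝ _ (by simp)
  have a5 : !₂[-1, s] ∈ Kmax s := subset_convexHull ℝ _ (by simp)
  have hlo := plane_mk_mem_of_abs_le hD a1 a2 a3 h0
  have hup : !₂[x 0, s] ∈ Kmax s := by
    have hb := abs_le.1 h0
    convert hD a4 a5 (a := (1 + x 0) / 2) (b := (1 - x 0) / 2) (by linarith) (by linarith)
      (by ring) using 1
    ext i
    fin_cases i <;> simp <;> ring
  refine plane_mk_mem_of_between hD hlo hup ?_ h1
  linear_combination h2

theorem convex_setOf_Kmax_bounds {s : ℝ} (hs : 1 < s) :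
    Convex ℝ {x : Plane | |x 0| ≤ 1 ∧ x 1 ≤ s ∧ -s ^ 2 + (s ^ 3 - s) * |x 0| ≤ x 1} := by
  have hs3 : 0 ≤ s ^ 3 - s := by nlinarith [mul_pos (sub_pos.2 hs) (by linarith : 0 < s)]
  rintro x ⟨hx1, hx2, hx3⟩ y ⟨hy1, hy2, hy3⟩ a b ha hb hab
  have habs : |(a • x + b • y) 0| ≤ a * |x 0| + b * |y 0| := by
    simp only [PiLp.add_apply, PiLp.smul_apply, smul_eq_mul]
    exact (abs_add_le _ _).trans (by rw [abs_mul, abs_mul, abs_of_nonneg ha, abs_of_nonneg hb])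
  have hab' : b = 1 - a := by linarith
  refine ⟨?_, ?_, ?_⟩
  · refine habs.trans ?_
    nlinarith
  · simp only [PiLp.add_apply, PiLp.smul_apply, smul_eq_mul]
    nlinarith
  · have h1 := mul_le_mul_of_nonneg_left habs hs3
    have h2 := mul_le_mul_of_nonneg_left hx3 ha
    have h3 := mul_le_mul_of_nonneg_left hy3 hb
    simp only [PiLp.add_apply, PiLp.smul_apply, smul_eq_mul] at h1 h2 h3 ⊢
    have h4 : s ^ 2 = a * s ^ 2 + b * s ^ 2 := by rw [← add_mul, hab, one_mul]
    linear_combination h1 + h2 + h3 - h4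

theorem mem_Kmax_iff {s : ℝ} (hs : 1 < s) (hs2 : s ≤ 2) {x : Plane} :
    x ∈ Kmax s ↔ |x 0| ≤ 1 ∧ x 1 ≤ s ∧ -s ^ 2 + (s ^ 3 - s) * |x 0| ≤ x 1 := by
  refine ⟨fun h => ?_, fun h => mem_Kmax_of h.1 h.2.1 h.2.2⟩
  refine convexHull_min ?_ (convex_setOf_Kmax_bounds hs) h
  -- This is `s * (s ^ 2 - s - 1) ≤ s`: the lower side vertices do not rise above the top edge.
  have h3 : s ^ 3 ≤ s ^ 2 + 2 * s := by nlinarith [mul_nonneg (by linarith : 0 ≤ s) (by nlinarith : 0 ≤ (2 - s) * (s + 1))]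
  rintro z (rfl | rfl | rfl | rfl | rfl) <;> simp <;>
    first
    | nlinarith
    | (constructor <;> nlinarith)

theorem alpha_eq_of_between {s : ℝ} (hs : 1 < s) (hs2 : s ≤ 2) {K : Set Plane}
    (hmin : Kmin s ⊆ K) (hmax : K ⊆ Kmax s) : alpha K = s / (s ^ 2 - 1) := by
  have hq : 0 < s ^ 2 - 1 := by nlinarith
  have hα : 0 < s / (s ^ 2 - 1) := div_pos (by linarith) hq
  set α := s / (s ^ 2 - 1) with hαdef
  have hαq : α * (s ^ 2 - 1) = s := div_mul_cancel₀ _ hq.ne'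
  rw [alpha_eq_iff hα]
  set C := convexHull ℝ (K ∪ -K) with hC
  have hCconv : Convex ℝ C := convex_convexHull ℝ _
  have hKC : K ⊆ C := Set.subset_union_left.trans (subset_convexHull ℝ _)
  have hKC' : -K ⊆ C := Set.subset_union_right.trans (subset_convexHull ℝ _)
  have vert : ∀ z : Plane, z ∈ ({!₂[α, 0], !₂[-α, 0], !₂[0, -s ^ 2],
    !₂[1, s], !₂[-1, s]} : Set Plane) → z ∈ K := fun z hz => hmin (subset_convexHull ℝ _ hz)
  have v1 : !₂[α, 0] ∈ K := vert _ (by simp)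
  have v2 : !₂[-α, 0] ∈ K := vert _ (by simp)
  have v3 : !₂[0, -s ^ 2] ∈ K := vert _ (by simp)
  have v4 : !₂[1, s] ∈ K := vert _ (by simp)
  have v5 : !₂[-1, s] ∈ K := vert _ (by simp)
  have negpt : ∀ x y x' y' : ℝ, !₂[x, y] ∈ K → x' = -x → y' = -y → !₂[x', y'] ∈ C := by
    rintro x y _ _ h rfl rfl
    refine hKC' ?_
    rw [Set.mem_neg]
    convert h using 1
    ext i
    fin_cases i <;> simp
  constructor
  · rintro x ⟨hx, hxn⟩
    obtain ⟨-, hy1, hy2⟩ := (mem_Kmax_iff hs hs2).1 (hmax hx)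
    obtain ⟨-, hy3, hy4⟩ := (mem_Kmax_iff hs hs2).1 (hmax hxn)
    simp only [PiLp.neg_apply, abs_neg] at hy3 hy4
    set X := |x 0| with hX
    have hX0 : 0 ≤ X := abs_nonneg _
    have hYX : |x 1| ≤ s ^ 2 - (s ^ 3 - s) * X := abs_le.2 ⟨by linarith, by linarith⟩
    have hYs : |x 1| ≤ s := abs_le.2 ⟨by linarith, by linarith⟩
    have hXα : X ≤ α := by
      have h1 : (s * (s ^ 2 - 1)) * X ≤ (s * (s ^ 2 - 1)) * α := by
        nlinarith [abs_nonneg (x 1)]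
      exact le_of_mul_le_mul_left h1 (by positivity)
    -- The bounds `hYs` and `hYX` cross at `X = 1 / (s + 1)`. There the claim reads `s (s - 1) / (s
    -- + 1) ≤ α`, which is equivalent to `s ≤ 2`.
    have hY : |x 1| ≤ α * s ^ 2 - (s ^ 2 - s) * X := by
      have e : α * s ^ 2 = s + α := by linear_combination hαq
      have e2 : α * (s + 1) * (s - 1) = s := by linear_combination hαq
      nlinarith [abs_nonneg (x 1), mul_nonneg hX0 (sub_nonneg.2 hs2),
        mul_nonneg hα.le (sub_nonneg.2 hs2)]
    have hmem : !₂[x 0 / α, x 1 / α] ∈ C := by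
      have hXd : |x 0 / α| = X / α := by rw [abs_div, abs_of_pos hα]
      have h1 : |x 0 / α| ≤ 1 := by rw [hXd]; exact (div_le_one hα).2 hXα
      have w3 : !₂[(0 : ℝ), s ^ 2] ∈ C := negpt _ _ _ _ v3 (by simp) (by simp)
      have w4 : !₂[(-1 : ℝ), -s] ∈ C := negpt _ _ _ _ v4 (by simp) (by simp)
      have w5 : !₂[(1 : ℝ), -s] ∈ C := negpt _ _ _ _ v5 (by simp) (by simp)
      have hlo := plane_mk_mem_of_abs_le hCconv (hKC v3) w5 w4 h1
      have hup := plane_mk_mem_of_abs_le hCconv w3 (hKC v4) (hKC v5) h1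
      have hb := abs_le.1 hY
      refine plane_mk_mem_of_between hCconv hlo hup ?_ ?_
      · rw [hXd, le_div_iff₀ hα]
        have : (X / α) * α = X := div_mul_cancel₀ _ hα.ne'
        linear_combination hb.1 + (-s + s ^ 2) * this
      · rw [hXd, div_le_iff₀ hα]
        have : (X / α) * α = X := div_mul_cancel₀ _ hα.ne'
        linear_combination hb.2 + (s ^ 2 - s) * this
    refine ⟨_, hmem, ?_⟩
    ext i
    fin_cases i <;> simp <;> field_simp
  -- Compare horizontal widths: `(±α, 0)` are at distance `2 α`, while `ρ α C` has width at most `2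
  -- ρ α`.
  · rintro ρ hρ0 hρ1 ⟨t, ht⟩
    have hbound : ∀ z ∈ C, |z 0| ≤ 1 := by
      have hconv : Convex ℝ {z : Plane | |z 0| ≤ 1} := by
        intro x hx y hy a b ha hb hab
        simp only [Set.mem_ofPred_eq, abs_le] at hx hy ⊢
        simp only [PiLp.add_apply, PiLp.smul_apply, smul_eq_mul]
        constructor <;> nlinarith
      refine convexHull_min ?_ hconv
      rintro z (hz | hz)
      · exact ((mem_Kmax_iff hs hs2).1 (hmax hz)).1
      · have := ((mem_Kmax_iff hs hs2).1 (hmax hz)).1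
        rwa [PiLp.neg_apply, abs_neg] at this
    have hn : ∀ x y : ℝ, !₂[x, 0] ∈ K → y = -x → !₂[y, 0] ∈ -K := by
      rintro x _ h rfl
      rw [Set.mem_neg]
      convert h using 1
      ext i
      fin_cases i <;> simp
    have key : ∀ x : ℝ, !₂[x, 0] ∈ K ∩ -K → |x - t 0| ≤ ρ * α := by
      intro x hx
      obtain ⟨_, ⟨_, ⟨z, hz, rfl⟩, rfl⟩, t', ht', hxz⟩ := ht hx
      obtain rfl : t' = t := ht'
      have h0 := congrArg (fun v : Plane => v 0) hxz
      simp at h0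
      have : x - t' 0 = ρ * (α * z 0) := by linarith
      rw [this, abs_mul, abs_mul, abs_of_nonneg hρ0, abs_of_pos hα]
      have := hbound z hz
      gcongr
      nlinarith
    have k1 := abs_le.1 (key α ⟨v1, hn _ _ v2 (by simp)⟩)
    have k2 := abs_le.1 (key (-α) ⟨v2, hn _ _ v1 (by simp)⟩)
    nlinarith

end ConvexAsym

/-! ### The equality case and part (a) -/

namespace ConvexAsym

open scoped RealInnerProductSpace

/-- The extremal case of the inequality `M ≤ s / (s² - 1)`: here `hᵢ` are the distances of the
origin to the sides of a triangle, `M = ⟪μ a₂ - ν a₃, p⟫` and `-b₁`, `-b₂` are the values of `a₃`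
and `a₂` at the opposite contact points. -/
theorem extremal_coefficients {s h₁ h₂ h₃ μ ν M b₁ b₂ : ℝ} (hs : 1 < s) (hh₂ : 0 < h₂)
    (hh₃ : 0 < h₃) (hμ : 0 ≤ μ) (hν : 0 ≤ ν) (hM : 0 < M) (hMle : M ≤ μ * h₂ + ν * h₃)
    (htri : s * h₁ ≤ h₂ + h₃) (hb₁ : b₁ ≤ h₁ - s * h₂) (hb₂ : b₂ ≤ h₁ - s * h₃)
    (h12 : s * (μ * (s * h₂) - ν * b₁) ≤ M * (s ^ 2 - 1))
    (h13 : s * (ν * (s * h₃) - μ * b₂) ≤ M * (s ^ 2 - 1)) :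
    h₂ = h₃ ∧ μ = ν ∧ 0 < μ ∧ M = 2 * μ * h₂ ∧ s * h₁ = 2 * h₂ ∧
      b₁ = h₁ - s * h₂ ∧ b₂ = h₁ - s * h₂ := by
  have hs0 : 0 < s := by linarith
  have hq : 0 < s ^ 2 - 1 := by nlinarith
  have hsb₁ : s * b₁ ≤ h₂ + h₃ - s ^ 2 * h₂ := by
    have := mul_le_mul_of_nonneg_left hb₁ hs0.le
    linear_combination this + htri
  have hsb₂ : s * b₂ ≤ h₂ + h₃ - s ^ 2 * h₃ := by
    have := mul_le_mul_of_nonneg_left hb₂ hs0.le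
    linear_combination this + htri
  have hMq : M * (s ^ 2 - 1) ≤ (μ * h₂ + ν * h₃) * (s ^ 2 - 1) :=
    mul_le_mul_of_nonneg_right hMle hq.le
  have e1 : h₂ * (μ - ν) ≤ s ^ 2 * ν * (h₃ - h₂) := by
    have := mul_le_mul_of_nonneg_left hsb₁ hν
    linear_combination this + h12 + hMq
  have e2 : h₃ * (ν - μ) ≤ s ^ 2 * μ * (h₂ - h₃) := by
    have := mul_le_mul_of_nonneg_left hsb₂ hμ
    linear_combination this + h13 + hMq
  -- Eliminating `n` from the two inequalities gives `m s² (y - x)² (s² - 1) ≤ 0`. Stating it for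
  -- general letters allows its use for both orders of `h₂` and `h₃`.
  have nolt : ∀ x y m n : ℝ, 0 < x → 0 < y → 0 ≤ m → 0 ≤ n → 0 < m * x + n * y →
      x * (m - n) ≤ s ^ 2 * n * (y - x) → y * (n - m) ≤ s ^ 2 * m * (x - y) → ¬ x < y := by
    intro x y m n hx hy hm hn hpos f1 f2 hxy
    have hD : 0 < y - x := sub_pos.2 hxy
    rcases hm.eq_or_lt with rfl | hm
    · have : 0 < n * y := by linarith
      nlinarith
    · have g1 : x * m ≤ (s ^ 2 * (y - x) + x) * n := by linear_combination f1
      have g2 : y * n ≤ (y - s ^ 2 * (y - x)) * m := by linear_combination f2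
      have hc : 0 < s ^ 2 * (y - x) + x := by positivity
      have g3 := mul_le_mul_of_nonneg_left g1 hy.le
      have g4 := mul_le_mul_of_nonneg_left g2 hc.le
      have g5 : m * (s ^ 2 * (y - x) ^ 2 * (s ^ 2 - 1)) ≤ 0 := by linear_combination g3 + g4
      have : 0 < m * (s ^ 2 * (y - x) ^ 2 * (s ^ 2 - 1)) := by positivity
      linarith
  have hpos : 0 < μ * h₂ + ν * h₃ := hM.trans_le hMle
  have hh : h₂ = h₃ := le_antisymm
    (not_lt.1 (nolt h₃ h₂ ν μ hh₃ hh₂ hν hμ (by linarith) e2 e1))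
    (not_lt.1 (nolt h₂ h₃ μ ν hh₂ hh₃ hμ hν hpos e1 e2))
  subst hh
  have hμν : μ = ν := by
    rw [sub_self, mul_zero] at e1 e2
    exact le_antisymm (by nlinarith) (by nlinarith)
  subst hμν
  have hμ0 : 0 < μ := pos_of_mul_pos_left (by linarith : 0 < μ * h₂) hh₂.le
  have hM1 : M = 2 * μ * h₂ := by
    refine le_antisymm (by linarith) ?_
    have := mul_le_mul_of_nonneg_left hsb₁ hμ
    refine le_of_mul_le_mul_right ?_ hq
    linear_combination h12 + this
  subst hM1
  have l1 : 2 * h₂ - s ^ 2 * h₂ ≤ s * b₁ := by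
    refine le_of_mul_le_mul_left ?_ hμ0
    linear_combination h12
  have l2 : 2 * h₂ - s ^ 2 * h₂ ≤ s * b₂ := by
    refine le_of_mul_le_mul_left ?_ hμ0
    linear_combination h13
  have hsh : s * h₁ = 2 * h₂ := by
    refine le_antisymm (by linarith) ?_
    have := mul_le_mul_of_nonneg_left hb₁ hs0.le
    linear_combination this + l1
  refine ⟨rfl, rfl, hμ0, rfl, hsh, le_antisymm hb₁ ?_, le_antisymm hb₂ ?_⟩
  · refine le_of_mul_le_mul_left ?_ hs0
    linear_combination l1 + hsh
  · refine le_of_mul_le_mul_left ?_ hs0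
    linear_combination l2 + hsh

/-- Three contact normals with the corresponding contact points, scaled to sum zero. -/
structure IsContactTriple (K : Set Plane) (s : ℝ) (a p : Fin 3 → Plane) : Prop where
  sum_eq_zero : a 0 + a 1 + a 2 = 0
  mem : ∀ i, p i ∈ K
  nonneg : ∀ i, ∀ x ∈ K, 0 ≤ s * ⟪a i, x⟫ + ⟪a i, p i⟫
  pos : ∀ i, 0 < ⟪a i, p i⟫
  span : ∀ v : Plane, ∃ c : Fin 3 → ℝ, v = c 0 • a 0 + c 1 • a 1 + c 2 • a 2

theorem IsContactTriple.comp_perm {K : Set Plane} {s : ℝ} {a p : Fin 3 → Plane}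
    (h : IsContactTriple K s a p) (σ : Equiv.Perm (Fin 3)) :
    IsContactTriple K s (a ∘ σ) (p ∘ σ) where
  sum_eq_zero := by
    have h1 := Equiv.sum_comp σ a
    rw [Fin.sum_univ_three, Fin.sum_univ_three, h.sum_eq_zero] at h1
    exact h1
  mem i := h.mem _
  nonneg i := h.nonneg _
  pos i := h.pos _
  span v := by
    obtain ⟨c, hc⟩ := h.span v
    have h1 := Equiv.sum_comp σ fun i => c i • a i
    rw [Fin.sum_univ_three, Fin.sum_univ_three, ← hc] at h1
    exact ⟨c ∘ σ, h1.symm⟩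

/-- Any vector is a difference of non-negative multiples of two of the three normals. -/
theorem IsContactTriple.exists_perm {K : Set Plane} {s : ℝ} {a p : Fin 3 → Plane}
    (h : IsContactTriple K s a p) (v : Plane) : ∃ σ : Equiv.Perm (Fin 3), ∃ μ ν : ℝ,
      0 ≤ μ ∧ 0 ≤ ν ∧ v = μ • a (σ 1) - ν • a (σ 2) := by
  obtain ⟨c, rfl⟩ := h.span v
  have hmono := Tuple.monotone_sort c
  let τ := Tuple.sort c
  have h01 : c (τ 0) ≤ c (τ 1) := hmono (by decide)
  have h12 : c (τ 1) ≤ c (τ 2) := hmono (by decide)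
  -- Since the normals sum to zero, the middle coefficient can be subtracted from all three. The
  -- largest then goes to index `1` and the smallest to index `2`.
  refine ⟨(Equiv.swap 0 2 * Equiv.swap 0 1 : Equiv.Perm (Fin 3)).trans τ,
    c (τ 2) - c (τ 1), c (τ 1) - c (τ 0), by linarith, by linarith, ?_⟩
  have h1 := (h.comp_perm τ).sum_eq_zero
  have h2 := Equiv.sum_comp τ fun i => c i • a i
  rw [Fin.sum_univ_three, Fin.sum_univ_three] at h2
  rw [← h2]
  simp only [Function.comp_apply] at h1
  have e1 : ((Equiv.swap 0 2 * Equiv.swap 0 1 : Equiv.Perm (Fin 3)).trans τ) 1 = τ 2 :=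
    congrArg τ (by decide)
  have e2 : ((Equiv.swap 0 2 * Equiv.swap 0 1 : Equiv.Perm (Fin 3)).trans τ) 2 = τ 0 :=
    congrArg τ (by decide)
  rw [e1, e2]
  have h3 : a (τ 1) = -a (τ 0) - a (τ 2) := by rw [← sub_eq_zero, ← h1]; abel
  rw [h3]
  module

/-- The linear coordinate map `x ↦ (⟪b, x⟫, ⟪c, x⟫)`. -/
noncomputable def innerPair (b c : Plane) : Plane →ₗ[ℝ] Plane :=
  (WithLp.linearEquiv 2 ℝ (Fin 2 → ℝ)).symm.toLinearMap ∘ₗ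
    LinearMap.pi ![(innerₛₗ ℝ b : Plane →ₗ[ℝ] ℝ), (innerₛₗ ℝ c : Plane →ₗ[ℝ] ℝ)]

theorem innerPair_apply (b c x : Plane) : innerPair b c x = !₂[⟪b, x⟫, ⟪c, x⟫] := by
  ext i
  fin_cases i <;> simp [innerPair]

theorem IsContactTriple.exists_linearEquiv {K : Set Plane} (hK : Convex ℝ K) {s : ℝ} (hs : 1 < s)
    {a q : Fin 3 → Plane} (h : IsContactTriple K s a q) {μ ν : ℝ} (hμ : 0 ≤ μ) (hν : 0 ≤ ν)
    {p : Plane} (hp : p ∈ K) (hpn : -p ∈ K) (hpos : 0 < ⟪μ • a 1 - ν • a 2, p⟫)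
    (hmax : ∀ x ∈ K, s / (s ^ 2 - 1) * |⟪μ • a 1 - ν • a 2, x⟫| ≤ ⟪μ • a 1 - ν • a 2, p⟫) :
    ∃ L : Plane ≃ₗ[ℝ] Plane, Kmin s ⊆ L '' K ∧ L '' K ⊆ Kmax s := by
  have hs0 : 0 < s := by linarith
  have hq : 0 < s ^ 2 - 1 := by nlinarith
  simp only [inner_sub_left, real_inner_smul_left] at hpos hmax
  have hsum : ∀ x, ⟪a 0, x⟫ + ⟪a 1, x⟫ + ⟪a 2, x⟫ = 0 := fun x => by
    rw [← inner_add_left, ← inner_add_left, h.sum_eq_zero, inner_zero_left]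
  obtain ⟨H, hH⟩ : ∃ H : Fin 3 → ℝ, ∀ i, ⟪a i, q i⟫ = s * H i :=
    ⟨fun i => ⟪a i, q i⟫ / s, fun i => by field_simp⟩
  have hHpos : ∀ i, 0 < H i := fun i => by
    have := h.pos i
    rw [hH] at this
    exact pos_of_mul_pos_right this hs0.le
  have hlow : ∀ i, ∀ x ∈ K, -H i ≤ ⟪a i, x⟫ := fun i x hx => by
    have := h.nonneg i x hx
    rw [hH, ← mul_add] at this
    have := nonneg_of_mul_nonneg_right this hs0
    linarith
  have hp1 := hlow 1 _ hpn
  have hp2 := hlow 2 _ hp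
  have hp0 := hsum p
  rw [inner_neg_right] at hp1
  set M := μ * ⟪a 1, p⟫ - ν * ⟪a 2, p⟫ with hMdef
  have hmax' : ∀ x ∈ K, s * |μ * ⟪a 1, x⟫ - ν * ⟪a 2, x⟫| ≤ M * (s ^ 2 - 1) := fun x hx => by
    have := hmax x hx
    rwa [div_mul_eq_mul_div, div_le_iff₀ hq] at this
  have t0 := hsum (q 0)
  have t1 := hsum (q 1)
  have t2 := hsum (q 2)
  have l01 := hlow 1 _ (h.mem 0)
  have l02 := hlow 2 _ (h.mem 0)
  have l10 := hlow 0 _ (h.mem 1)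
  have l20 := hlow 0 _ (h.mem 2)
  have m1 := (mul_le_mul_of_nonneg_left (le_abs_self _) hs0.le).trans (hmax' _ (h.mem 1))
  have m2 := (mul_le_mul_of_nonneg_left (neg_le_abs _) hs0.le).trans (hmax' _ (h.mem 2))
  have H0 := hH 0
  have H1 := hH 1
  have H2 := hH 2
  -- Uses that both `p` and `-p` lie in the triangle.
  have hMle : M ≤ μ * H 1 + ν * H 2 := by
    have e1 := mul_le_mul_of_nonneg_left (by linarith : ⟪a 1, p⟫ ≤ H 1) hμ
    have e2 := mul_le_mul_of_nonneg_left (by linarith : -⟪a 2, p⟫ ≤ H 2) hν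
    linear_combination e1 + e2
  obtain ⟨hh, rfl, hμ0, hM, hsh, hb1, hb2⟩ := extremal_coefficients (h₁ := H 0) (b₁ := ⟪a 2, q 1⟫)
    (b₂ := ⟪a 1, q 2⟫) hs (hHpos 1) (hHpos 2) hμ hν hpos hMle (by linarith) (by linarith)
    (by linarith) (by rwa [← H1]) (by rw [← H2]; linarith)
  have hη : 0 < H 1 := hHpos 1
  set η := H 1 with hηdef
  rw [← hh] at hp2 H2 l02
  have hpe : ⟪a 1, p⟫ - ⟪a 2, p⟫ = 2 * η := by
    refine mul_left_cancel₀ hμ0.ne' ?_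
    linear_combination hM - hMdef
  have q01 : ⟪a 1, q 0⟫ = -η := by linarith
  have q02 : ⟪a 2, q 0⟫ = -η := by linarith
  have hH0 : H 0 = 2 * η / s := by rw [eq_div_iff hs0.ne']; linarith
  -- The factors are fixed by sending `p`, where `a 1 - a 2` equals `2 η`, to first coordinate `s /
  -- (s ^ 2 - 1)`, and `q 0`, where `a 0` equals `2 η`, to second coordinate `-s ^ 2`.
  let b : Plane := (s / (2 * η * (s ^ 2 - 1))) • (a 1 - a 2)
  let c : Plane := (-(s ^ 2 / (2 * η))) • a 0
  have hb : ∀ x, ⟪b, x⟫ = s / (2 * η * (s ^ 2 - 1)) * (⟪a 1, x⟫ - ⟪a 2, x⟫) := fun x => by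
    rw [real_inner_smul_left, inner_sub_left]
  have hc : ∀ x, ⟪c, x⟫ = -(s ^ 2 / (2 * η)) * ⟪a 0, x⟫ := fun x => real_inner_smul_left _ _ _
  have hinj : Function.Injective (innerPair b c) := by
    rw [← LinearMap.ker_eq_bot, LinearMap.ker_eq_bot']
    intro x hx
    rw [innerPair_apply] at hx
    have x0 := congrArg (fun v : Plane => v 0) hx
    have x1 := congrArg (fun v : Plane => v 1) hx
    simp only [PiLp.zero_apply, Matrix.cons_val_zero, Matrix.cons_val_one] at x0 x1
    rw [hb, mul_eq_zero, or_iff_right (by positivity)] at x0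
    rw [hc, mul_eq_zero, or_iff_right (neg_ne_zero.2 (by positivity))] at x1
    have x2 := hsum x
    obtain ⟨d, hd⟩ := h.span x
    have hxx : ⟪x, x⟫ = 0 := by
      conv_lhs => arg 2; rw [hd]
      rw [inner_add_left, inner_add_left, real_inner_smul_left, real_inner_smul_left,
        real_inner_smul_left, x1, (by linarith : ⟪a 1, x⟫ = 0), (by linarith : ⟪a 2, x⟫ = 0)]
      ring
    exact inner_self_eq_zero.1 hxx
  refine ⟨LinearEquiv.ofInjectiveEndo _ hinj, ?_, ?_⟩
  · refine convexHull_min ?_ (hK.linear_image (LinearEquiv.ofInjectiveEndo _ hinj).toLinearMap)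
    have img : ∀ x ∈ K, ∀ y z : ℝ, y = ⟪b, x⟫ → z = ⟪c, x⟫ →
        !₂[y, z] ∈ LinearEquiv.ofInjectiveEndo _ hinj '' K := by
      rintro x hx _ _ rfl rfl
      exact ⟨x, hx, innerPair_apply b c x⟩
    have a0p : ⟪a 0, p⟫ = 0 := by linarith
    have a0q1 : ⟪a 0, q 1⟫ = -(2 * η / s) := by linarith
    have a0q2 : ⟪a 0, q 2⟫ = -(2 * η / s) := by linarith
    have hd1 : ⟪a 1, q 1⟫ - ⟪a 2, q 1⟫ = 2 * η * (s ^ 2 - 1) / s := by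
      rw [H1, hb1, hH0]; field_simp; ring
    have hd2 : ⟪a 1, q 2⟫ - ⟪a 2, q 2⟫ = -(2 * η * (s ^ 2 - 1) / s) := by
      rw [H2, hb2, hH0]; field_simp; ring
    rintro _ (rfl | rfl | rfl | rfl | rfl)
    · refine img p hp _ _ ?_ ?_
      · rw [hb, hpe]; field_simp
      · rw [hc, a0p, mul_zero]
    · refine img (-p) hpn _ _ ?_ ?_
      · rw [inner_neg_right, hb, hpe]; field_simp
      · rw [inner_neg_right, hc, a0p, mul_zero, neg_zero]
    · refine img (q 0) (h.mem 0) _ _ ?_ ?_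
      · rw [hb, q01, q02, sub_self, mul_zero]
      · rw [hc, H0, hsh]; field_simp
    · refine img (q 1) (h.mem 1) _ _ ?_ ?_
      · rw [hb, hd1]; field_simp
      · rw [hc, a0q1]; field_simp
    · refine img (q 2) (h.mem 2) _ _ ?_ ?_
      · rw [hb, hd2]; field_simp
      · rw [hc, a0q2]; field_simp
  · rintro _ ⟨x, hx, rfl⟩
    have hx0 : (LinearEquiv.ofInjectiveEndo _ hinj) x = !₂[⟪b, x⟫, ⟪c, x⟫] :=
      innerPair_apply b c x
    rw [hx0]
    have u0 := hlow 0 x hx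
    have u1 := hlow 1 x hx
    have u2 := hlow 2 x hx
    have u3 := hsum x
    rw [← hηdef] at u1
    rw [← hh] at u2
    have habs : |⟪b, x⟫| = s / (2 * η * (s ^ 2 - 1)) * |⟪a 1, x⟫ - ⟪a 2, x⟫| := by
      rw [hb, abs_mul, abs_of_pos (by positivity)]
    refine mem_Kmax_of ?_ ?_ ?_
    · change |⟪b, x⟫| ≤ 1
      have h1 := hmax' x hx
      rw [← mul_sub, abs_mul, abs_of_pos hμ0, hM] at h1
      rw [habs, div_mul_eq_mul_div, div_le_one (by positivity)]
      refine le_of_mul_le_mul_left ?_ hμ0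
      linear_combination h1
    · change ⟪c, x⟫ ≤ s
      rw [hc]
      have h1 : s ^ 2 / (2 * η) * -⟪a 0, x⟫ ≤ s ^ 2 / (2 * η) * (2 * η / s) :=
        mul_le_mul_of_nonneg_left (by linarith) (by positivity)
      have h2 : s ^ 2 / (2 * η) * (2 * η / s) = s := by field_simp
      linarith
    · change -s ^ 2 + (s ^ 3 - s) * |⟪b, x⟫| ≤ ⟪c, x⟫
      rw [habs, hc]
      -- The two sides with normals `a 1` and `a 2`, combined with `a 1 + a 2 = -a 0`, become the
      -- slanted edges of `Kmax`.
      have h1 : |⟪a 1, x⟫ - ⟪a 2, x⟫| ≤ 2 * η - ⟪a 0, x⟫ :=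
        abs_le.2 ⟨by linarith, by linarith⟩
      have h2 := mul_le_mul_of_nonneg_left h1 (by positivity : 0 ≤ s ^ 2 / (2 * η))
      have h3 : (s ^ 3 - s) * (s / (2 * η * (s ^ 2 - 1)) * |⟪a 1, x⟫ - ⟪a 2, x⟫|)
          = s ^ 2 / (2 * η) * |⟪a 1, x⟫ - ⟪a 2, x⟫| := by
        field_simp
      have h4 : s ^ 2 / (2 * η) * (2 * η) = s ^ 2 := by field_simp
      rw [h3]
      linear_combination h2 + h4

theorem exists_isContactTriple {K : Set Plane} (hK : IsBody K) (hc : IsMinkowskiCentered K)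
    (hs : 1 < asymmetry K) : ∃ a p : Fin 3 → Plane, IsContactTriple K (asymmetry K) a p := by
  have hs0 : 0 < asymmetry K := by linarith
  have hposN : ∀ a : Plane, ‖a‖ = 1 → ∀ p, (∀ x ∈ K, 0 ≤ asymmetry K * ⟪a, x⟫ + ⟪a, p⟫) →
      0 < ⟪a, p⟫ := by
    intro a ha p hp
    obtain ⟨x, hx, hneg⟩ := hc.exists_inner_neg hK hs0 (a := a) (by rintro rfl; simp at ha)
    have := hp x hx
    nlinarith
  obtain ⟨ι, _, z, w, hz, hind, hw, hw1, hsum⟩ :=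
    eq_pos_convex_span_of_mem_convexHull (zero_mem_convexHull_contactNormals hK hc hs)
  have hcard : Fintype.card ι ≤ 3 := by
    have h1 := hind.card_le_finrank_succ
    have h2 := Submodule.finrank_le (vectorSpan ℝ (Set.range z))
    have h3 : Module.finrank ℝ Plane = 2 := by simp
    omega
  have hzN : ∀ i, z i ∈ contactNormals K (asymmetry K) := fun i => hz ⟨i, rfl⟩
  choose hnorm p hpK hp using hzN
  have hcard3 : Fintype.card ι = 3 := by
    obtain h | h | h | h : Fintype.card ι = 0 ∨ Fintype.card ι = 1 ∨ Fintype.card ι = 2 ∨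
      Fintype.card ι = 3 := by omega
    · have := Fintype.card_eq_zero_iff.1 h
      simp at hw1
    · obtain ⟨i, hi⟩ := Fintype.card_eq_one_iff.1 h
      have : Unique ι := ⟨⟨i⟩, hi⟩
      rw [Fintype.sum_unique, smul_eq_zero, or_iff_right (hw _).ne'] at hsum
      have := hnorm default
      rw [hsum, norm_zero] at this
      exact absurd this zero_ne_one
    · obtain ⟨e⟩ := Fintype.card_eq.1 (h.trans (Fintype.card_fin 2).symm)
      rw [← Equiv.sum_comp e.symm, Fin.sum_univ_two] at hsum
      set i := e.symm 0
      set j := e.symm 1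
      have hin : ∀ x, w i * ⟪z i, x⟫ + w j * ⟪z j, x⟫ = 0 := fun x => by
        rw [← real_inner_smul_left, ← real_inner_smul_left, ← inner_add_left, hsum,
          inner_zero_left]
      -- With two opposite normals, each of `w i * ⟪z i, p i⟫` and `w j * ⟪z j, p j⟫` would be at
      -- least `s` times the other, impossible for positive numbers and `s > 1`.
      have f1 := mul_nonneg (hw i).le (hp i _ (hpK j))
      have f2 := mul_nonneg (hw j).le (hp j _ (hpK i))
      have g1 := hposN _ (hnorm i) _ (hp i)
      have g2 := hposN _ (hnorm j) _ (hp j)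
      have e1 := hin (p i)
      have e2 := hin (p j)
      have g1' := mul_pos (hw i) g1
      have g2' := mul_pos (hw j) g2
      nlinarith
    · exact h
  obtain ⟨e⟩ := Fintype.card_eq.1 (hcard3.trans (Fintype.card_fin 3).symm)
  refine ⟨fun k => w (e.symm k) • z (e.symm k), fun k => p (e.symm k), ?_, fun k => hpK _,
    fun k x hx => ?_, fun k => ?_, fun v => ?_⟩
  · rw [← Equiv.sum_comp e.symm, Fin.sum_univ_three] at hsum
    exact hsum
  · rw [real_inner_smul_left, real_inner_smul_left]
    have := mul_nonneg (hw (e.symm k)).le (hp (e.symm k) x hx)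
    linarith
  · rw [real_inner_smul_left]
    exact mul_pos (hw _) (hposN _ (hnorm _) _ (hp _))
  -- Three affinely independent points affinely span the plane, so they also span it linearly.
  · have htop : affineSpan ℝ (Set.range z) = ⊤ := by
      rw [hind.affineSpan_eq_top_iff_card_eq_finrank_add_one, hcard3]
      simp
    have hv : v ∈ Submodule.span ℝ (Set.range z) := by
      have : v ∈ affineSpan ℝ (Set.range z) := htop ▸ AffineSubspace.mem_top ℝ Plane v
      exact affineSpan_subset_span this
    obtain ⟨c, rfl⟩ := (Submodule.mem_span_range_iff_exists_fun ℝ).1 hv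
    refine ⟨fun k => c (e.symm k) / w (e.symm k), ?_⟩
    rw [← Equiv.sum_comp e.symm, Fin.sum_univ_three]
    simp only [smul_smul, div_mul_cancel₀ _ (hw _).ne']

theorem exists_linearEquiv_of_alpha_eq {K : Set Plane} (hK : IsBody K)
    (hc : IsMinkowskiCentered K) (hs : 1 < asymmetry K)
    (hα : alpha K = asymmetry K / (asymmetry K ^ 2 - 1)) :
    ∃ L : Plane ≃ₗ[ℝ] Plane, Kmin (asymmetry K) ⊆ L '' K ∧ L '' K ⊆ Kmax (asymmetry K) := by
  have hs0 : 0 < asymmetry K := by linarith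
  have hq : 0 < asymmetry K ^ 2 - 1 := by nlinarith
  have hα0 : 0 < asymmetry K / (asymmetry K ^ 2 - 1) := div_pos hs0 hq
  obtain ⟨v, hv, p, hp, hpn, hmax⟩ :=
    exists_touching_of_optContained hK ((alpha_eq_iff hα0).1 hα)
  have hpos : 0 < ⟪v, p⟫ := by
    obtain ⟨x, hx, hneg⟩ := hc.exists_inner_neg hK hs0 (a := v) (by rintro rfl; simp at hv)
    exact (mul_pos hα0 (abs_pos.2 hneg.ne)).trans_le (hmax x hx)
  obtain ⟨a, q, h⟩ := exists_isContactTriple hK hc hs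
  obtain ⟨σ, μ, ν, hμ, hν, rfl⟩ := h.exists_perm v
  exact (h.comp_perm σ).exists_linearEquiv hK.convex hs hμ hν hp hpn hpos hmax

end ConvexAsym

theorem lemma4p4 :
    (∀ K : Set ConvexAsym.Plane, ConvexAsym.IsBody K → ConvexAsym.IsMinkowskiCentered K →
      Real.goldenRatio < ConvexAsym.asymmetry K →
      ConvexAsym.alpha K = ConvexAsym.asymmetry K / (ConvexAsym.asymmetry K ^ 2 - 1) →
      ∃ L : ConvexAsym.Plane ≃ₗ[ℝ] ConvexAsym.Plane,
        ConvexAsym.Kmin (ConvexAsym.asymmetry K) ⊆ L '' K ∧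
        L '' K ⊆ ConvexAsym.Kmax (ConvexAsym.asymmetry K)) ∧
    (∀ s : ℝ, Real.goldenRatio < s → s ≤ 2 →
      ∀ K : Set ConvexAsym.Plane, ConvexAsym.IsBody K →
        ConvexAsym.Kmin s ⊆ K → K ⊆ ConvexAsym.Kmax s →
        ConvexAsym.alpha K = s / (s ^ 2 - 1)) :=
  ⟨fun _ hK hc hs hα =>
    ConvexAsym.exists_linearEquiv_of_alpha_eq hK hc (Real.one_lt_goldenRatio.trans hs) hα,
   fun _ hs hs2 _ _ hmin hmax =>
    ConvexAsym.alpha_eq_of_between (Real.one_lt_goldenRatio.trans hs) hs2 hmin hmax⟩
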